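/- For real numbers $\lambda_1\le\dots\le\lambda_n$ let $GZ(\lambda_1\,\dots\,\lambda_n)\subset\mathbb R^{n(n-1)/2}$ be the Gelfand–Zetlin polytope: the set of all points $(u_{i,j})_{1\le i\le n-1,\ 1\le j\le n-i}$ such that, with $u_{0,j}:=\lambda_j$, $$u_{i-1,j}\le u_{i,j}\le u_{i-1,j+1}\qquad(1\le i\le n-1,\ 1\le j\le n-i).$$ Exponents denote repetition: $GZ(1\,2\,3^k)$ corresponds to the sequence $1,2$ followed by $k$ threes, and $GZ(2^2\,3^k)$ to the sequence $2,2$ followed by $k$ threes. For a polytope $P$ of dimension $d$ let $f_i$ be the number of its nonempty faces of dimension $i$ ($P$ itself is its face of dimension $d$), and put $f_P(t)=\sum_{i=0}^{d}f_i t^i$ and $h_P(s)=f_P(s-1)$. Define polynomials $\Phi_k\in\mathbb Z[s]$ by $$\Phi_0=0,\qquad \Phi_1=1,\qquad \Phi_{k+1}=(s^2+s)\,\Phi_k-s^2\,\Phi_{k-1}\quad(k\ge 1).$$ Then for every integer $k\ge 0$ the following identities hold in the field of rational functions in $s$: $$\text{(A)}\quad h_{GZ(1\,2\,3^k)}(s)=\sum_{j=0}^{k}\frac{s^{j+2}-1}{s-1}\,\Phi_{k-j+1},$$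 $$\text{(B)}\quad h_{GZ(2^2\,3^k)}(s)=\sum_{j=0}^{k}s^{j+2}\,\Phi_{k-j}+\frac{s^{k+1}-1}{s-1}.$$ -/

import Mathlib

open Polynomial

/-- Positions of the free entries of a triangular table whose top row has `n` entries:
`(i, j)` with `i + j + 1 < n`.  Both coordinates are counted from `0`, so that `(i, j)` is the
position of the classical coordinate `u_{i+1, j+1}`, where `1 ≤ i + 1 ≤ n - 1` and
`1 ≤ j + 1 ≤ n - (i + 1)`. -/
abbrev GZIndex (n : ℕ) : Type := {p : ℕ × ℕ // p.1 + p.2 + 1 < n}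

/-- The entries of the triangular table with top row `l` and free entries `u`: row `0` is `l`, and
row `i + 1` consists of the free entries `u (i, j)`. -/
def gzEntry (l : List ℝ) (u : GZIndex l.length → ℝ) : (i j : ℕ) → i + j < l.length → ℝ
  | 0, j, h => l[j]'(by omega)
  | i + 1, j, h => u ⟨(i, j), by simp only; omega⟩

/-- The Gelfand–Zetlin polytope of the sequence `l`: the set of all `u` such that `a ≤ b ≤ c`
whenever `a`, `c` are neighbours in some row of the table and `b` is the entry of the next row
that stands between them. -/
def gzPolytope (l : List ℝ) : Set (GZIndex l.length → ℝ) :=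
  {u | ∀ (i j : ℕ) (h : i + 1 + j < l.length),
    gzEntry l u i j (by omega) ≤ gzEntry l u (i + 1) j h ∧
      gzEntry l u (i + 1) j h ≤ gzEntry l u i (j + 1) (by omega)}

noncomputable section

/-- The dimension of a set: the dimension of its affine span (`0` for the empty set). -/
def polytopeDim {E : Type*} [AddCommGroup E] [Module ℝ E] (P : Set E) : ℕ :=
  Module.finrank ℝ (vectorSpan ℝ P)

/-- The set of nonempty faces of `P` of dimension `i`.  Faces are the sets of maximizers on `P` of
linear functionals; the zero functional gives `P` itself. -/
def facesOfDim {E : Type*} [AddCommGroup E] [Module ℝ E] [TopologicalSpace E]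
    (P : Set E) (i : ℕ) : Set (Set E) :=
  {F | F.Nonempty ∧ IsExposed ℝ P F ∧ polytopeDim F = i}

/-- The `f`-polynomial `f_0 + f_1 t + ⋯ + f_n t^n`, where `n = dim P` and `f_i` is the number of
faces of `P` of dimension `i`. -/
def fPolynomial {E : Type*} [AddCommGroup E] [Module ℝ E] [TopologicalSpace E]
    (P : Set E) : ℤ[X] :=
  ∑ i ∈ Finset.range (polytopeDim P + 1), C ((facesOfDim P i).ncard : ℤ) * X ^ i

/-- The `h`-polynomial `h(s) = f(s - 1)`. -/
def hPolynomial {E : Type*} [AddCommGroup E] [Module ℝ E] [TopologicalSpace E]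
    (P : Set E) : ℤ[X] :=
  (fPolynomial P).comp (X - 1)

/-- The sequence `Φ_0 = 0`, `Φ_1 = 1`, `Φ_{k+1} = (s² + s) Φ_k - s² Φ_{k-1}` of polynomials
in `s`. -/
def gzPhi : ℕ → ℤ[X]
  | 0 => 0
  | 1 => 1
  | k + 2 => (X ^ 2 + X) * gzPhi (k + 1) - X ^ 2 * gzPhi k

end

/-! A nonempty face of a polyhedron is determined by which inequalities are tight on its relative
interior. For a Gelfand–Zetlin polytope these are equalities between entries and their upper
neighbours, recorded by `tableCode`. The face has as its dimension the number of entries equal to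
neither upper neighbour, so its `f`-polynomial is `codePoly` (`fPolynomial_gzPolytope`).

The codes available below a row depend only on the order pattern of that row
(`SameOrder.gzCodes_eq`), and the equalities with the row above fix the pattern of the next row.
Hence `codePoly` can be computed one row at a time (`codePoly_succ`). Below `a, b, 3, 3, …` the next
row is `p, q, 3, 3, …`, with `p` and `q` each at an end or in the interior of an interval. With `S`,
`D`, `B` the `f`-polynomials for `2 3^k`, `1 2 3^k`, `2^2 3^k`, this gives a closed linear system of
recurrences.

After the substitution `t = s - 1`, eliminating `B` from the system gives `D (k+2) = (s² + s) D
(k+1) - s² D k + S (k+3)`; eliminating `D` shows that `B (k+1) - S (k+1)` obeys the same recurrence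
with inhomogeneous term `s^(k+4)`. The homogeneous part is the recurrence of `Φ`, so both solutions
are convolutions with `Φ`. -/

/-! ### Faces of a polyhedron given by finitely many inequalities -/

section Polyhedron

variable {E ι : Type*} [AddCommGroup E] [Module ℝ E]

/-- The polyhedron cut out by the inequalities `a i u ≤ 0`. -/
def polyhedron (a : ι → E →ᵃ[ℝ] ℝ) : Set E := {u | ∀ i, a i u ≤ 0}

/-- The smallest face containing `u` of the polyhedron cut out by `a`: the points at which all
constraints active at `u` are active. -/
def polyhedronFace (a : ι → E →ᵃ[ℝ] ℝ) (u : E) : Set E :=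
  {w ∈ polyhedron a | ∀ i, a i u = 0 → a i w = 0}

theorem mem_polyhedronFace_self {a : ι → E →ᵃ[ℝ] ℝ} {u : E} (hu : u ∈ polyhedron a) :
    u ∈ polyhedronFace a u := ⟨hu, fun _ h => h⟩

theorem polyhedronFace_eq_iff {a : ι → E →ᵃ[ℝ] ℝ} {u w : E} (hu : u ∈ polyhedron a)
    (hw : w ∈ polyhedron a) :
    polyhedronFace a u = polyhedronFace a w ↔ ∀ i, a i u = 0 ↔ a i w = 0 := by
  constructor
  · intro h i
    have h1 : w ∈ polyhedronFace a u := h ▸ mem_polyhedronFace_self hw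
    have h2 : u ∈ polyhedronFace a w := h ▸ mem_polyhedronFace_self hu
    exact ⟨h1.2 i, h2.2 i⟩
  · intro h
    ext x
    simp [polyhedronFace, h]

theorem affineMap_add_smul (f : E →ᵃ[ℝ] ℝ) (u v : E) (r : ℝ) :
    f (u + r • v) = f u + r * f.linear v := by
  have h := f.map_vadd u (r • v)
  simp only [vadd_eq_add, map_smul, smul_eq_mul] at h
  rw [add_comm u, h, add_comm]

/-- Inactive constraints have slack at `u`, and there are finitely many of them, so every small
enough `r` works. -/
theorem exists_pos_add_smul_mem_polyhedronFace [Finite ι] {a : ι → E →ᵃ[ℝ] ℝ} {u v : E}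
    (hu : u ∈ polyhedron a) (hv : ∀ i, a i u = 0 → (a i).linear v = 0) :
    ∃ r : ℝ, 0 < r ∧ u + r • v ∈ polyhedronFace a u := by
  have h : ∀ᶠ r : ℝ in nhdsWithin 0 (Set.Ioi 0), ∀ i, a i (u + r • v) ≤ 0 := by
    rw [Filter.eventually_all]
    intro i
    simp only [affineMap_add_smul]
    by_cases h0 : a i u = 0
    · simp [h0, hv i h0]
    · have hlt : a i u < 0 := lt_of_le_of_ne (hu i) h0
      have hc : Continuous fun r : ℝ => a i u + r * (a i).linear v := by fun_prop
      have ht : Filter.Tendsto (fun r : ℝ => a i u + r * (a i).linear v) (nhds 0)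
          (nhds (a i u)) := by simpa using hc.tendsto 0
      exact ((ht.eventually (gt_mem_nhds hlt)).mono fun r hr => le_of_lt hr).filter_mono
        nhdsWithin_le_nhds
  obtain ⟨r, hr, hpos⟩ := (h.and self_mem_nhdsWithin).exists
  refine ⟨r, hpos, hr, fun i hi => ?_⟩
  rw [affineMap_add_smul, hi, hv i hi]
  simp

theorem vectorSpan_polyhedronFace [Finite ι] {a : ι → E →ᵃ[ℝ] ℝ} {u : E}
    (hu : u ∈ polyhedron a) :
    vectorSpan ℝ (polyhedronFace a u) =
      ⨅ i : {i // a i u = 0}, LinearMap.ker (a i).linear := by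
  apply le_antisymm
  · rw [vectorSpan_def, Submodule.span_le]
    rintro _ ⟨x, hx, y, hy, rfl⟩
    simp only [SetLike.mem_coe, Submodule.mem_iInf, LinearMap.mem_ker, Subtype.forall]
    intro i hi
    rw [AffineMap.linearMap_vsub, hx.2 i hi, hy.2 i hi]
    simp
  · intro v hv
    simp only [Submodule.mem_iInf, LinearMap.mem_ker, Subtype.forall] at hv
    obtain ⟨r, hr, hmem⟩ := exists_pos_add_smul_mem_polyhedronFace hu hv
    have h := vsub_mem_vectorSpan ℝ hmem (mem_polyhedronFace_self hu)
    simp only [vsub_eq_sub, add_sub_cancel_left] at h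
    have := Submodule.smul_mem _ r⁻¹ h
    rwa [smul_smul, inv_mul_cancel₀ hr.ne', one_smul] at this

variable [TopologicalSpace E]

theorem isExposed_polyhedronFace [Finite ι] [IsTopologicalAddGroup E] [ContinuousSMul ℝ E]
    [T2Space E] [FiniteDimensional ℝ E] {a : ι → E →ᵃ[ℝ] ℝ} {u : E} (hu : u ∈ polyhedron a) :
    IsExposed ℝ (polyhedron a) (polyhedronFace a u) := by
  classical
  have := Fintype.ofFinite ι
  intro _
  set S : Finset ι := {i | a i u = 0} with hS
  -- The sum of the active linear parts differs by a constant from the sum of the active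
  -- constraints, which on the polyhedron is at most `0`, with equality exactly where each summand
  -- vanishes.
  refine ⟨LinearMap.toContinuousLinearMap (∑ i ∈ S, (a i).linear), ?_⟩
  have key : ∀ x, (∑ i ∈ S, (a i).linear) x = ∑ i ∈ S, a i x + (∑ i ∈ S, (a i).linear) u := by
    intro x
    rw [LinearMap.sum_apply, LinearMap.sum_apply, ← Finset.sum_add_distrib]
    refine Finset.sum_congr rfl fun i hi => ?_
    have h : a i u = 0 := by simpa [hS] using hi
    have h1 := affineMap_add_smul (a i) u (x - u) 1
    simp only [one_smul, add_sub_cancel, map_sub, h] at h1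
    linarith
  ext x
  simp only [polyhedronFace, Set.mem_ofPred_eq, LinearMap.coe_toContinuousLinearMap']
  refine and_congr_right fun hx => ?_
  constructor
  · intro h y hy
    rw [key x, key y, Finset.sum_eq_zero fun i hi => h i (by simpa [hS] using hi)]
    gcongr
    exact Finset.sum_nonpos fun i _ => hy i
  · intro h
    have h1 := h u hu
    rw [key x, le_add_iff_nonneg_left] at h1
    have h2 := (Finset.sum_eq_zero_iff_of_nonpos fun i _ => hx i).1
      (le_antisymm (Finset.sum_nonpos fun i (_ : i ∈ S) => hx i) h1)
    exact fun i hi => h2 i (by simpa [hS] using hi)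

theorem exists_eq_polyhedronFace [Finite ι] {a : ι → E →ᵃ[ℝ] ℝ} {F : Set E}
    (hne : F.Nonempty) (hF : IsExposed ℝ (polyhedron a) F) :
    ∃ u ∈ polyhedron a, F = polyhedronFace a u := by
  obtain ⟨l, rfl⟩ := hF hne
  -- A point of `F` with fewest active constraints plays the role of a relative interior point: if
  -- some `w` in `F` lost one of them, the midpoint of `u` and `w` would have fewer still.
  obtain ⟨u, hu, hmin⟩ := WellFounded.has_min
    (measure fun u : E => {i | a i u = 0}.ncard).wf _ hne
  refine ⟨u, hu.1, Set.Subset.antisymm ?_ ?_⟩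
  · intro w hw
    refine ⟨hw.1, ?_⟩
    by_contra! hex
    obtain ⟨i, hiu, hiw⟩ := hex
    have hm : ∀ j, a j (u + (1 / 2 : ℝ) • (w - u)) = (a j u + a j w) / 2 := by
      intro j
      have h1 := affineMap_add_smul (a j) u (w - u) 1
      rw [one_smul, add_sub_cancel] at h1
      rw [affineMap_add_smul]
      linarith
    refine hmin (u + (1 / 2 : ℝ) • (w - u)) ⟨fun j => ?_, fun y hy => ?_⟩ ?_
    · rw [hm]
      linarith [hu.1 j, hw.1 j]
    · have h1 := hu.2 y hy
      have h2 := hw.2 y hy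
      simp only [map_add, map_smul, map_sub, smul_eq_mul]
      linarith
    · refine Set.ncard_lt_ncard ⟨fun j hj => ?_, fun hsub => ?_⟩ (Set.toFinite _)
      · have h1 : a j _ = 0 := hj
        rw [hm] at h1
        exact (by linarith [hu.1 j, hw.1 j] : a j u = 0)
      · have h1 : a i _ = 0 := hsub (show a i u = 0 from hiu)
        rw [hm, hiu] at h1
        exact hiw (by linarith)
  · intro w hw
    refine ⟨hw.1, fun y hy => (hu.2 y hy).trans ?_⟩
    -- From `u` one can move slightly past `u`, away from `w`, inside the polyhedron. If the
    -- functional were smaller at `w` than at `u`, it would exceed its maximum there.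
    obtain ⟨r, hr, hmem⟩ := exists_pos_add_smul_mem_polyhedronFace (v := u - w) hu.1 (by
      intro i hi
      have h1 := affineMap_add_smul (a i) w (u - w) 1
      rw [one_smul, add_sub_cancel, hi, hw.2 i hi] at h1
      linarith)
    have h2 := hu.2 _ hmem.1
    simp only [map_add, map_smul, map_sub, smul_eq_mul] at h2
    by_contra! hlt
    nlinarith [mul_pos hr (sub_pos.2 hlt)]

end Polyhedron

/-! ### Tables, their equality codes, and the row-by-row recursion -/

section Tables

/-- The first `n` rows of `T` form a Gelfand–Zetlin table with top row of length `n`. -/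
def IsGZTable (n : ℕ) (T : ℕ → ℕ → ℝ) : Prop :=
  ∀ i j, i + 1 + j < n → T i j ≤ T (i + 1) j ∧ T (i + 1) j ≤ T i (j + 1)

open Classical in
/-- The equalities between the entries of a row `y` of length `n` and their neighbours in the row
`x` above. -/
noncomputable def rowCode (n : ℕ) (x y : ℕ → ℝ) : List (Bool × Bool) :=
  (List.range n).map fun j => (decide (y j = x j), decide (y j = x (j + 1)))

/-- The equalities between vertically neighbouring entries of a table. -/
noncomputable def tableCode : ℕ → (ℕ → ℕ → ℝ) → List (List (Bool × Bool))
  | 0, _ => []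
  | n + 1, T => rowCode n (T 0) (T 1) :: tableCode n (fun i => T (i + 1))

/-- The number of entries that differ from both of their upper neighbours. -/
def freeCount (c : List (List (Bool × Bool))) : ℕ :=
  (c.map (List.count (false, false))).sum

theorem rowCode_eq_iff {n : ℕ} {x y x' y' : ℕ → ℝ} :
    rowCode n x y = rowCode n x' y' ↔ ∀ j < n,
      (y j = x j ↔ y' j = x' j) ∧ (y j = x (j + 1) ↔ y' j = x' (j + 1)) := by
  simp [rowCode, List.map_inj_left]

theorem tableCode_eq_iff {n : ℕ} {T T' : ℕ → ℕ → ℝ} :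
    tableCode n T = tableCode n T' ↔ ∀ i j, i + 1 + j < n →
      (T (i + 1) j = T i j ↔ T' (i + 1) j = T' i j) ∧
      (T (i + 1) j = T i (j + 1) ↔ T' (i + 1) j = T' i (j + 1)) := by
  induction n generalizing T T' with
  | zero => simp [tableCode]
  | succ n ih =>
    rw [tableCode, tableCode, List.cons_eq_cons, rowCode_eq_iff, ih]
    constructor
    · rintro ⟨h0, h1⟩ i j hij
      cases i with
      | zero => exact h0 j (by omega)
      | succ i => exact h1 i j (by omega)
    · intro h
      exact ⟨fun j hj => h 0 j (by omega), fun i j hij => h (i + 1) j (by omega)⟩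

theorem finite_range_tableCode (n : ℕ) : (Set.range (tableCode n)).Finite := by
  induction n with
  | zero => exact (Set.finite_singleton []).subset (by rintro _ ⟨T, rfl⟩; rfl)
  | succ n ih =>
    refine ((List.finite_length_eq (Bool × Bool) n).image2 List.cons ih).subset ?_
    rintro _ ⟨T, rfl⟩
    exact ⟨_, by simp [rowCode], _, ⟨_, rfl⟩, rfl⟩

theorem count_rowCode (n : ℕ) (x y : ℕ → ℝ) :
    (rowCode n x y).count (false, false) = {j | j < n ∧ y j ≠ x j ∧ y j ≠ x (j + 1)}.ncard := by
  classical
  rw [rowCode, List.count, List.countP_map, List.countP_eq_length_filter,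
    ← List.toFinset_card_of_nodup (List.nodup_range.filter _), ← Set.ncard_coe_finset]
  congr 1
  ext j
  simp

instance finite_GZIndex (n : ℕ) : Finite (GZIndex n) := by
  refine Finite.of_injective (fun p : GZIndex n =>
    ((⟨p.1.1, by have := p.2; omega⟩, ⟨p.1.2, by have := p.2; omega⟩) : Fin n × Fin n)) ?_
  rintro ⟨⟨i, j⟩, hp⟩ ⟨⟨i', j'⟩, hq⟩ h
  simpa using h

theorem freeCount_tableCode (n : ℕ) (T : ℕ → ℕ → ℝ) :
    freeCount (tableCode n T) =
      Nat.card {p : GZIndex n // T (p.1.1 + 1) p.1.2 ≠ T p.1.1 p.1.2 ∧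
        T (p.1.1 + 1) p.1.2 ≠ T p.1.1 (p.1.2 + 1)} := by
  induction n generalizing T with
  | zero =>
    have : IsEmpty (GZIndex 0) := ⟨fun p => by have := p.2; omega⟩
    simp [tableCode, freeCount]
  | succ n ih =>
    have h := ih fun i => T (i + 1)
    rw [freeCount] at h
    rw [tableCode, freeCount, List.map_cons, List.sum_cons, h, count_rowCode,
      ← Nat.card_coe_set_eq]
    have hf : Finite {j | j < n ∧ T 1 j ≠ T 0 j ∧ T 1 j ≠ T 0 (j + 1)} :=
      ((Set.finite_Iio n).subset fun j hj => hj.1)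
    rw [← Nat.card_sum]
    refine Nat.card_congr
      { toFun := Sum.elim (fun j => ⟨⟨(0, j.1), by have := j.2.1; simp only; omega⟩, j.2.2⟩)
          fun p => ⟨⟨(p.1.1.1 + 1, p.1.1.2), by have := p.1.2; simp only; omega⟩, p.2⟩
        invFun := fun p => match p with
          | ⟨⟨(0, j), h⟩, h'⟩ => Sum.inl ⟨j, by simp only at h; omega, h'⟩
          | ⟨⟨(i + 1, j), h⟩, h'⟩ => Sum.inr ⟨⟨(i, j), by simp only at h ⊢; omega⟩, h'⟩
        left_inv := ?_
        right_inv := ?_ }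
    · rintro (⟨j, hj⟩ | ⟨⟨⟨i, j⟩, hij⟩, hp⟩) <;> rfl
    · rintro ⟨⟨⟨_ | i, j⟩, hij⟩, hp⟩ <;> rfl

/-- The entry `T i (j + 1)` is squeezed between the two lower ones. Horizontal ties below the top
row are therefore encoded by vertical equalities. -/
theorem IsGZTable.row_tie_iff {n : ℕ} {T : ℕ → ℕ → ℝ} (hT : IsGZTable n T) {i j : ℕ}
    (h : i + 1 + j + 1 < n) :
    T (i + 1) j = T (i + 1) (j + 1) ↔
      T (i + 1) j = T i (j + 1) ∧ T (i + 1) (j + 1) = T i (j + 1) := by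
  have h1 := (hT i j (by omega)).2
  have h2 := (hT i (j + 1) (by omega)).1
  constructor
  · intro h
    constructor <;> linarith
  · rintro ⟨h3, h4⟩
    rw [h3, h4]

open Classical in
/-- The table with top row `x` that has the vertical equalities of `T` and whose remaining entries
are given by `f` in terms of the position and the two upper neighbours. -/
noncomputable def liftTable (T : ℕ → ℕ → ℝ) (x : ℕ → ℝ) (f : ℕ → ℕ → ℝ → ℝ → ℝ) : ℕ → ℕ → ℝ
  | 0, j => x j
  | i + 1, j =>
    if T (i + 1) j = T i j then liftTable T x f i j
    else if T (i + 1) j = T i (j + 1) then liftTable T x f i (j + 1)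
    else f i j (liftTable T x f i j) (liftTable T x f i (j + 1))

section Lift

variable {n : ℕ} {T : ℕ → ℕ → ℝ} {x : ℕ → ℝ} {f : ℕ → ℕ → ℝ → ℝ → ℝ}

theorem liftTable_of_left {i j : ℕ} (h : T (i + 1) j = T i j) :
    liftTable T x f (i + 1) j = liftTable T x f i j := by
  rw [liftTable, if_pos h]

theorem liftTable_of_free {i j : ℕ} (h : T (i + 1) j ≠ T i j) (h' : T (i + 1) j ≠ T i (j + 1)) :
    liftTable T x f (i + 1) j = f i j (liftTable T x f i j) (liftTable T x f i (j + 1)) := by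
  rw [liftTable, if_neg h, if_neg h']

/-- `liftTable` prefers the left neighbour. When an entry of `T` equals both upper neighbours, the
right equality survives in the lift only because ties in the row above do. -/
theorem liftTable_row_tie (hT : IsGZTable n T)
    (hx : ∀ j, j + 1 < n → T 0 j = T 0 (j + 1) → x j = x (j + 1)) {i j : ℕ} (h : i + j + 1 < n)
    (hij : T i j = T i (j + 1)) : liftTable T x f i j = liftTable T x f i (j + 1) := by
  induction i generalizing j with
  | zero => exact hx j (by omega) hij
  | succ i ih =>
    obtain ⟨h1, h2⟩ := (hT.row_tie_iff (by omega)).1 hij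
    rw [liftTable_of_left h2]
    by_cases h3 : T (i + 1) j = T i j
    · rw [liftTable_of_left h3, ih (by omega) (h3 ▸ h1)]
    · rw [liftTable, if_neg h3, if_pos h1]

theorem liftTable_of_right (hT : IsGZTable n T)
    (hx : ∀ j, j + 1 < n → T 0 j = T 0 (j + 1) → x j = x (j + 1)) {i j : ℕ} (h : i + 1 + j < n)
    (hij : T (i + 1) j = T i (j + 1)) :
    liftTable T x f (i + 1) j = liftTable T x f i (j + 1) := by
  by_cases h3 : T (i + 1) j = T i j
  · rw [liftTable_of_left h3, liftTable_row_tie hT hx (by omega) (h3 ▸ hij)]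
  · rw [liftTable, if_neg h3, if_pos hij]

/-- A Gelfand–Zetlin table can be transported to every top row with the same order pattern. -/
theorem exists_isGZTable_of_row (hT : IsGZTable n T)
    (hx : ∀ j, j + 1 < n → x j ≤ x (j + 1) ∧ (T 0 j = T 0 (j + 1) ↔ x j = x (j + 1))) :
    ∃ T', T' 0 = x ∧ IsGZTable n T' ∧ tableCode n T' = tableCode n T := by
  -- A free entry of `T` forces its two upper neighbours to be distinct. The lift preserves this, so
  -- the midpoint lies strictly between them and creates no new equality.
  set V := liftTable T x fun _ _ a b => (a + b) / 2 with hV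
  have hx' := fun j hj => (hx j hj).2.1
  have step : ∀ i j, i + 1 + j < n → V i j ≤ V i (j + 1) ∧ (T i j = T i (j + 1) ↔
      V i j = V i (j + 1)) → (V i j ≤ V (i + 1) j ∧ V (i + 1) j ≤ V i (j + 1)) ∧
      (V (i + 1) j = V i j ↔ T (i + 1) j = T i j) ∧
      (V (i + 1) j = V i (j + 1) ↔ T (i + 1) j = T i (j + 1)) := by
    intro i j hij ⟨hle, htie⟩
    have hT' := hT i j hij
    by_cases h1 : T (i + 1) j = T i j
    · have h := liftTable_of_left (x := x) (f := fun _ _ a b => (a + b) / 2) h1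
      rw [← hV] at h
      rw [h, h1]
      simpa [hle] using htie.symm
    · by_cases h2 : T (i + 1) j = T i (j + 1)
      · have h := liftTable_of_right (f := fun _ _ a b => (a + b) / 2) hT hx' hij h2
        rw [← hV] at h
        rw [h, h2]
        simpa [hle, eq_comm] using htie.symm
      · have h := liftTable_of_free (x := x) (f := fun _ _ a b => (a + b) / 2) h1 h2
        rw [← hV] at h
        have hne : V i j ≠ V i (j + 1) := fun h3 => by
          have := htie.2 h3
          exact h1 (by linarith)
        have hlt := lt_of_le_of_ne hle hne
        simp only [h, h1, h2, iff_false]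
        refine ⟨⟨by linarith, by linarith⟩, fun h => by linarith, fun h => by linarith⟩
  have rows : ∀ i j, i + 1 + j < n →
      V i j ≤ V i (j + 1) ∧ (T i j = T i (j + 1) ↔ V i j = V i (j + 1)) := by
    intro i
    induction i with
    | zero => exact fun j hj => hx j (by omega)
    | succ i ih =>
      intro j hij
      have h1 := step i j (by omega) (ih j (by omega))
      have h2 := step i (j + 1) (by omega) (ih (j + 1) (by omega))
      refine ⟨h1.1.2.trans h2.1.1, ?_⟩
      rw [hT.row_tie_iff (by omega), ← h1.2.2, ← h2.2.1]
      constructor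
      · rintro ⟨h3, h4⟩
        rw [h3, h4]
      · intro h3
        have h4 := h1.1.2
        have h5 := h2.1.1
        constructor <;> linarith
  refine ⟨V, funext fun j => rfl, fun i j hij => (step i j hij (rows i j hij)).1, ?_⟩
  rw [tableCode_eq_iff]
  exact fun i j hij => (step i j hij (rows i j hij)).2

end Lift

/-- The codes of the Gelfand–Zetlin tables with top row `x 0, …, x (n - 1)`. -/
def gzCodes (n : ℕ) (x : ℕ → ℝ) : Set (List (List (Bool × Bool))) :=
  tableCode n '' {T | T 0 = x ∧ IsGZTable n T}

theorem finite_gzCodes (n : ℕ) (x : ℕ → ℝ) : (gzCodes n x).Finite :=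
  (finite_range_tableCode n).subset (Set.image_subset_range _ _)

/-- Two rows of length `n` are both weakly increasing, with equalities at the same places. -/
def SameOrder (n : ℕ) (x y : ℕ → ℝ) : Prop :=
  ∀ j, j + 1 < n → x j ≤ x (j + 1) ∧ y j ≤ y (j + 1) ∧ (x j = x (j + 1) ↔ y j = y (j + 1))

theorem SameOrder.symm {n : ℕ} {x y : ℕ → ℝ} (h : SameOrder n x y) : SameOrder n y x :=
  fun j hj => ⟨(h j hj).2.1, (h j hj).1, (h j hj).2.2.symm⟩

theorem SameOrder.gzCodes_eq {n : ℕ} {x y : ℕ → ℝ} (h : SameOrder n x y) :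
    gzCodes n x = gzCodes n y := by
  have key : ∀ {x y : ℕ → ℝ}, SameOrder n x y → gzCodes n x ⊆ gzCodes n y := by
    rintro x y h _ ⟨T, ⟨rfl, hT⟩, rfl⟩
    obtain ⟨T', h1, h2, h3⟩ := exists_isGZTable_of_row hT fun j hj => (h j hj).2
    exact ⟨T', ⟨h1, h2⟩, h3⟩
  exact (key h).antisymm (key h.symm)

/-- The row `y` of length `n` interlaces the row `x` above it. -/
def Interlaces (n : ℕ) (x y : ℕ → ℝ) : Prop := ∀ j < n, x j ≤ y j ∧ y j ≤ x (j + 1)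

/-- Since `y j ≤ x (j + 1) ≤ y (j + 1)`, a tie in the lower row means that both entries equal `x (j
+ 1)`, which the code records. -/
theorem Interlaces.sameOrder {n : ℕ} {x y z : ℕ → ℝ} (hy : Interlaces n x y)
    (hz : Interlaces n x z) (h : rowCode n x y = rowCode n x z) : SameOrder n y z := by
  rw [rowCode_eq_iff] at h
  intro j hj
  have hy1 := (hy j (by omega)).2
  have hy2 := (hy (j + 1) hj).1
  have hz1 := (hz j (by omega)).2
  have hz2 := (hz (j + 1) hj).1
  have h1 := (h j (by omega)).2
  have h2 := (h (j + 1) hj).1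
  refine ⟨hy1.trans hy2, hz1.trans hz2, fun h3 => ?_, fun h3 => ?_⟩
  · rw [h1.1 (by linarith), h2.1 (by linarith)]
  · rw [h1.2 (by linarith), h2.2 (by linarith)]

/-- The generating polynomial of the codes, by number of free entries. -/
noncomputable def codePoly (n : ℕ) (x : ℕ → ℝ) : ℤ[X] := ∑ᶠ c ∈ gzCodes n x, X ^ freeCount c

theorem SameOrder.codePoly_eq {n : ℕ} {x y : ℕ → ℝ} (h : SameOrder n x y) :
    codePoly n x = codePoly n y := by
  rw [codePoly, h.gzCodes_eq, codePoly]

theorem mem_gzCodes_succ {n : ℕ} {x : ℕ → ℝ} {c : List (List (Bool × Bool))} :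
    c ∈ gzCodes (n + 1) x ↔
      ∃ y, Interlaces n x y ∧ ∃ d ∈ gzCodes n y, rowCode n x y :: d = c := by
  constructor
  · rintro ⟨T, ⟨rfl, hT⟩, rfl⟩
    exact ⟨T 1, fun j hj => hT 0 j (by omega), _,
      ⟨fun i => T (i + 1), ⟨rfl, fun i j hij => hT (i + 1) j (by omega)⟩, rfl⟩, rfl⟩
  · rintro ⟨y, hy, _, ⟨T, ⟨rfl, hT⟩, rfl⟩, rfl⟩
    refine ⟨fun i => Nat.casesOn i x T, ⟨rfl, fun i j hij => ?_⟩, rfl⟩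
    cases i with
    | zero => exact hy j (by omega)
    | succ i => exact hT i j (by omega)

/-- The recursion on the number of rows: `y` runs over representatives of the order patterns of
the second row. -/
theorem codePoly_succ {ι : Type*} [Fintype ι] {n : ℕ} {x : ℕ → ℝ} (y : ι → ℕ → ℝ)
    (hy : ∀ i, Interlaces n x (y i)) (hinj : Function.Injective fun i => rowCode n x (y i))
    (hsurj : ∀ z, Interlaces n x z → ∃ i, rowCode n x z = rowCode n x (y i)) :
    codePoly (n + 1) x =
      ∑ i, X ^ (rowCode n x (y i)).count (false, false) * codePoly n (y i) := by
  have hU : gzCodes (n + 1) x = ⋃ i, (rowCode n x (y i) :: ·) '' gzCodes n (y i) := by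
    ext c
    rw [mem_gzCodes_succ, Set.mem_iUnion]
    constructor
    · rintro ⟨z, hz, d, hd, rfl⟩
      obtain ⟨i, hi⟩ := hsurj z hz
      rw [(hz.sameOrder (hy i) hi).gzCodes_eq] at hd
      exact ⟨i, d, hd, by rw [hi]⟩
    · rintro ⟨i, d, hd, rfl⟩
      exact ⟨y i, hy i, d, hd, rfl⟩
  rw [codePoly, hU, finsum_mem_iUnion, finsum_eq_sum_of_fintype]
  · refine Finset.sum_congr rfl fun i _ => ?_
    rw [finsum_mem_image (List.cons_injective.injOn), codePoly,
      mul_finsum_mem]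
    refine finsum_mem_congr rfl fun c _ => ?_
    simp [freeCount, pow_add]
  · intro i j hij
    rw [Function.onFun, Set.disjoint_left]
    rintro _ ⟨c, -, rfl⟩ ⟨d, -, h⟩
    exact hij (hinj (List.cons_eq_cons.1 h).1.symm)
  · exact fun i => (finite_gzCodes n (y i)).image _

end Tables

/-! ### Faces of the Gelfand–Zetlin polytope as codes -/

section Faces

/-- The table with top row `x` and free entries `u`, extended by zero. -/
def gzTable (n : ℕ) (x : ℕ → ℝ) (u : GZIndex n → ℝ) : ℕ → ℕ → ℝ
  | 0, j => x j
  | i + 1, j => if h : i + j + 1 < n then u ⟨(i, j), h⟩ else 0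

theorem gzTable_succ {n : ℕ} {x : ℕ → ℝ} {u : GZIndex n → ℝ} {i j : ℕ} (h : i + j + 1 < n) :
    gzTable n x u (i + 1) j = u ⟨(i, j), h⟩ := dif_pos h

/-- An entry of the table as an affine function of the free entries. -/
def gzTableAffine (n : ℕ) (x : ℕ → ℝ) (i j : ℕ) : (GZIndex n → ℝ) →ᵃ[ℝ] ℝ where
  toFun u := gzTable n x u i j
  linear :=
    { toFun := fun v => gzTable n 0 v i j
      map_add' := fun v w => by
        cases i with
        | zero => simp [gzTable]
        | succ i => by_cases h : i + j + 1 < n <;> simp [gzTable, h]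
      map_smul' := fun r v => by
        cases i with
        | zero => simp [gzTable]
        | succ i => by_cases h : i + j + 1 < n <;> simp [gzTable, h] }
  map_vadd' u v := by
    cases i with
    | zero => simp [gzTable]
    | succ i => by_cases h : i + j + 1 < n <;> simp [gzTable, h]

/-- The inequalities between the entry at `p` and its two upper neighbours. -/
def gzConstraint (n : ℕ) (x : ℕ → ℝ) : GZIndex n × Bool → (GZIndex n → ℝ) →ᵃ[ℝ] ℝ
  | (p, false) => gzTableAffine n x p.1.1 p.1.2 - gzTableAffine n x (p.1.1 + 1) p.1.2
  | (p, true) => gzTableAffine n x (p.1.1 + 1) p.1.2 - gzTableAffine n x p.1.1 (p.1.2 + 1)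

theorem mem_polyhedron_gzConstraint {n : ℕ} {x : ℕ → ℝ} {u : GZIndex n → ℝ} :
    u ∈ polyhedron (gzConstraint n x) ↔ IsGZTable n (gzTable n x u) := by
  simp only [polyhedron, Set.mem_ofPred_eq, Prod.forall, Bool.forall_bool, gzConstraint,
    IsGZTable, Subtype.forall, AffineMap.coe_sub, Pi.sub_apply, sub_nonpos]
  exact ⟨fun h i j hij => h i j (by omega), fun h i j hij => h i j (by omega)⟩

theorem gzPolytope_eq_polyhedron (l : List ℝ) :
    gzPolytope l = polyhedron (gzConstraint l.length fun j => l.getD j 0) := by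
  have key : ∀ u i j h, gzEntry l u i j h = gzTable l.length (fun j => l.getD j 0) u i j := by
    intro u i j h
    cases i with
    | zero =>
      rw [gzEntry, gzTable, List.getD_eq_getElem]
    | succ i => rw [gzEntry, gzTable_succ]
  ext u
  rw [mem_polyhedron_gzConstraint]
  simp only [gzPolytope, Set.mem_ofPred_eq, key, IsGZTable]

theorem polyhedronFace_gzConstraint_eq_iff {n : ℕ} {x : ℕ → ℝ} {u w : GZIndex n → ℝ}
    (hu : u ∈ polyhedron (gzConstraint n x)) (hw : w ∈ polyhedron (gzConstraint n x)) :
    polyhedronFace (gzConstraint n x) u = polyhedronFace (gzConstraint n x) w ↔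
      tableCode n (gzTable n x u) = tableCode n (gzTable n x w) := by
  rw [polyhedronFace_eq_iff hu hw, tableCode_eq_iff]
  simp only [Prod.forall, Bool.forall_bool, gzConstraint, Subtype.forall, AffineMap.coe_sub,
    Pi.sub_apply, sub_eq_zero]
  have e : ∀ a b : ℝ, a = b ↔ b = a := fun _ _ => eq_comm
  constructor
  · intro h i j hij
    have := h i j (by omega)
    exact ⟨(e _ _).trans (this.1.trans (e _ _)), this.2⟩
  · intro h i j hij
    have := h i j (by omega)
    exact ⟨(e _ _).trans (this.1.trans (e _ _)), this.2⟩

theorem mem_vectorSpan_gzFace {n : ℕ} {x : ℕ → ℝ} {u v : GZIndex n → ℝ}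
    (hu : u ∈ polyhedron (gzConstraint n x)) :
    v ∈ vectorSpan ℝ (polyhedronFace (gzConstraint n x) u) ↔ ∀ i j, i + 1 + j < n →
      (gzTable n x u (i + 1) j = gzTable n x u i j →
        gzTable n 0 v (i + 1) j = gzTable n 0 v i j) ∧
      (gzTable n x u (i + 1) j = gzTable n x u i (j + 1) →
        gzTable n 0 v (i + 1) j = gzTable n 0 v i (j + 1)) := by
  rw [vectorSpan_polyhedronFace hu]
  simp only [Submodule.mem_iInf, LinearMap.mem_ker, Subtype.forall, Prod.forall,
    Bool.forall_bool, gzConstraint, AffineMap.coe_sub, AffineMap.sub_linear, Pi.sub_apply,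
    LinearMap.sub_apply, sub_eq_zero]
  constructor
  · intro h i j hij
    have := h i j (by omega)
    exact ⟨fun h' => (this.1 h'.symm).symm, this.2⟩
  · intro h i j hij
    have := h i j (by omega)
    exact ⟨fun h' => (this.1 h'.symm).symm, this.2⟩

/-- The direction space consists of the tables with top row zero obeying the vertical equalities of
`T`. Restriction to the free positions `Q` is an isomorphism: the other entries are copied from
above, and values at `Q` extend by `liftTable`. -/
theorem polytopeDim_gzFace {n : ℕ} {x : ℕ → ℝ} {u : GZIndex n → ℝ}
    (hu : u ∈ polyhedron (gzConstraint n x)) :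
    polytopeDim (polyhedronFace (gzConstraint n x) u) =
      freeCount (tableCode n (gzTable n x u)) := by
  classical
  set T := gzTable n x u with hTdef
  have hT : IsGZTable n T := mem_polyhedron_gzConstraint.1 hu
  rw [freeCount_tableCode]
  set Q := {p : GZIndex n // T (p.1.1 + 1) p.1.2 ≠ T p.1.1 p.1.2 ∧
    T (p.1.1 + 1) p.1.2 ≠ T p.1.1 (p.1.2 + 1)}
  set W := vectorSpan ℝ (polyhedronFace (gzConstraint n x) u) with hW
  have : Fintype Q := Fintype.ofFinite Q
  have hbij : Function.Bijective
      ((LinearMap.funLeft ℝ ℝ (fun q : Q => q.1)).comp W.subtype) := by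
    constructor
    · rw [← LinearMap.ker_eq_bot, LinearMap.ker_eq_bot']
      rintro ⟨v, hv⟩ h0
      rw [hW, mem_vectorSpan_gzFace hu] at hv
      have h0' : ∀ q : Q, v q.1 = 0 := fun q => congrFun h0 q
      have hz : ∀ i j, i + j < n → gzTable n 0 v i j = 0 := by
        intro i
        induction i with
        | zero => exact fun j _ => rfl
        | succ i ih =>
          intro j hij
          have hv' := hv i j (by omega)
          by_cases h1 : T (i + 1) j = T i j
          · rw [hv'.1 h1, ih j (by omega)]
          · by_cases h2 : T (i + 1) j = T i (j + 1)
            · rw [hv'.2 h2, ih (j + 1) (by omega)]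
            · rw [gzTable_succ (by omega)]
              exact h0' ⟨⟨(i, j), by simp only; omega⟩, h1, h2⟩
      ext ⟨⟨i, j⟩, hij⟩
      have h := hz (i + 1) j (by simp only at hij; omega)
      rwa [gzTable_succ hij] at h
    · intro g
      -- The existential recovers an element of `Q` from its position; the default `0` is never used
      -- at a position in `Q`.
      set V := liftTable T 0 fun i j _ _ =>
        if h : ∃ q : Q, q.1.1 = (i, j) then g h.choose else 0 with hV
      have hv : ∀ i j, i + j < n → gzTable n 0 (fun p => V (p.1.1 + 1) p.1.2) i j = V i j := by
        intro i j hij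
        cases i with
        | zero => rfl
        | succ i => rw [gzTable_succ (by omega)]
      refine ⟨⟨fun p => V (p.1.1 + 1) p.1.2, ?_⟩, ?_⟩
      · rw [hW, mem_vectorSpan_gzFace hu]
        intro i j hij
        rw [hv _ _ (by omega), hv _ _ (by omega), hv _ _ (by omega)]
        exact ⟨liftTable_of_left, liftTable_of_right hT (fun _ _ _ => rfl) hij⟩
      · ext q
        change V (q.1.1.1 + 1) q.1.1.2 = g q
        have h : ∃ q' : Q, q'.1.1 = (q.1.1.1, q.1.1.2) := ⟨q, rfl⟩
        rw [hV, liftTable_of_free q.2.1 q.2.2, dif_pos h]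
        congr 1
        exact Subtype.ext (Subtype.ext h.choose_spec)
  rw [polytopeDim, (LinearEquiv.ofBijective _ hbij).finrank_eq, Module.finrank_fintype_fun_eq_card,
    Nat.card_eq_fintype_card]

theorem gzCodes_eq_image (n : ℕ) (x : ℕ → ℝ) :
    gzCodes n x =
      (fun u => tableCode n (gzTable n x u)) '' polyhedron (gzConstraint n x) := by
  ext c
  constructor
  · rintro ⟨T, ⟨rfl, hT⟩, rfl⟩
    have key : ∀ i j, i + j < n →
        gzTable n (T 0) (fun p => T (p.1.1 + 1) p.1.2) i j = T i j := by
      intro i j hij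
      cases i with
      | zero => rfl
      | succ i => rw [gzTable_succ (by omega)]
    refine ⟨fun p => T (p.1.1 + 1) p.1.2, ?_, ?_⟩
    · rw [mem_polyhedron_gzConstraint]
      intro i j hij
      rw [key _ _ (by omega), key _ _ (by omega), key _ _ (by omega)]
      exact hT i j hij
    · rw [tableCode_eq_iff]
      intro i j hij
      rw [key _ _ (by omega), key _ _ (by omega), key _ _ (by omega)]
      exact ⟨Iff.rfl, Iff.rfl⟩
  · rintro ⟨u, hu, rfl⟩
    exact ⟨gzTable n x u, ⟨rfl, mem_polyhedron_gzConstraint.1 hu⟩, rfl⟩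

theorem ncard_image_eq_of_eq_iff {α β γ : Type*} {s : Set α} {f : α → β} {g : α → γ}
    (h : ∀ a ∈ s, ∀ b ∈ s, f a = f b ↔ g a = g b) : (f '' s).ncard = (g '' s).ncard := by
  refine Set.ncard_congr (fun c hc => g hc.choose)
    (fun c hc => ⟨_, hc.choose_spec.1, rfl⟩) (fun c d hc hd he => ?_) ?_
  · rw [← hc.choose_spec.2, ← hd.choose_spec.2]
    exact (h _ hc.choose_spec.1 _ hd.choose_spec.1).2 he
  · rintro _ ⟨a, ha, rfl⟩
    have hc : f a ∈ f '' s := ⟨a, ha, rfl⟩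
    exact ⟨f a, hc, (h _ hc.choose_spec.1 _ ha).1 hc.choose_spec.2⟩

theorem facesOfDim_polyhedron_gzConstraint (n : ℕ) (x : ℕ → ℝ) (d : ℕ) :
    facesOfDim (polyhedron (gzConstraint n x)) d =
      polyhedronFace (gzConstraint n x) ''
        {u ∈ polyhedron (gzConstraint n x) | freeCount (tableCode n (gzTable n x u)) = d} := by
  ext F
  constructor
  · rintro ⟨hne, hF, hd⟩
    obtain ⟨u, hu, rfl⟩ := exists_eq_polyhedronFace hne hF
    exact ⟨u, ⟨hu, by rw [← hd, polytopeDim_gzFace hu]⟩, rfl⟩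
  · rintro ⟨u, ⟨hu, hd⟩, rfl⟩
    exact ⟨⟨u, mem_polyhedronFace_self hu⟩, isExposed_polyhedronFace hu,
      by rw [polytopeDim_gzFace hu, hd]⟩

theorem ncard_facesOfDim_gz (n : ℕ) (x : ℕ → ℝ) (d : ℕ) :
    (facesOfDim (polyhedron (gzConstraint n x)) d).ncard =
      {c ∈ gzCodes n x | freeCount c = d}.ncard := by
  rw [facesOfDim_polyhedron_gzConstraint, ncard_image_eq_of_eq_iff fun u hu w hw =>
    polyhedronFace_gzConstraint_eq_iff hu.1 hw.1, gzCodes_eq_image]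
  congr 1
  ext c
  constructor
  · rintro ⟨u, ⟨hu, hd⟩, rfl⟩
    exact ⟨⟨u, hu, rfl⟩, hd⟩
  · rintro ⟨⟨u, hu, rfl⟩, hd⟩
    exact ⟨u, ⟨hu, hd⟩, rfl⟩

theorem fPolynomial_gzPolytope (l : List ℝ) :
    fPolynomial (gzPolytope l) = codePoly l.length fun j => l.getD j 0 := by
  classical
  rw [gzPolytope_eq_polyhedron]
  set n := l.length
  set x : ℕ → ℝ := fun j => l.getD j 0
  have hfin := finite_gzCodes n x
  rw [codePoly, finsum_mem_eq_finite_toFinset_sum _ hfin, fPolynomial]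
  -- A face has dimension at most that of the polytope, so cutting the sum off at `polytopeDim`
  -- loses no code.
  have hmaps : ∀ c ∈ hfin.toFinset, freeCount c ∈
      Finset.range (polytopeDim (polyhedron (gzConstraint n x)) + 1) := by
    intro c hc
    rw [Set.Finite.mem_toFinset, gzCodes_eq_image] at hc
    obtain ⟨u, hu, rfl⟩ := hc
    rw [Finset.mem_range, Nat.lt_succ_iff, ← polytopeDim_gzFace hu]
    exact Submodule.finrank_mono (vectorSpan_mono ℝ fun w hw => hw.1)
  rw [← Finset.sum_fiberwise_of_maps_to hmaps]
  refine Finset.sum_congr rfl fun d _ => ?_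
  rw [ncard_facesOfDim_gz, Finset.sum_congr rfl fun c hc => by rw [(Finset.mem_filter.1 hc).2],
    Finset.sum_const, ← Set.ncard_coe_finset]
  simp

end Faces

/-! ### Recurrences for the three families -/

section Recurrences

/-- The row `a, b, c, c, c, …`. -/
def row3 (a b c : ℝ) : ℕ → ℝ
  | 0 => a
  | 1 => b
  | _ + 2 => c

/-- Representatives of the three possible positions in the interval `[a, b]`. -/
noncomputable def posIn (a b : ℝ) : Fin 3 → ℝ := ![a, (a + b) / 2, b]

theorem posIn_zero (a b : ℝ) : posIn a b 0 = a := rfl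

theorem posIn_one (a b : ℝ) : posIn a b 1 = (a + b) / 2 := rfl

theorem posIn_two (a b : ℝ) : posIn a b 2 = b := rfl

theorem posIn_mem {a b : ℝ} (h : a < b) (i : Fin 3) : a ≤ posIn a b i ∧ posIn a b i ≤ b := by
  have e1 : a ≤ (a + b) / 2 := by linarith
  have e2 : (a + b) / 2 ≤ b := by linarith
  fin_cases i <;> simp [posIn, h.le, e1, e2]

theorem posIn_injective {a b : ℝ} (h : a < b) {i j : Fin 3}
    (h1 : posIn a b i = a ↔ posIn a b j = a) (h2 : posIn a b i = b ↔ posIn a b j = b) :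
    i = j := by
  have e1 : (a + b) / 2 ≠ a := by intro h; linarith
  have e2 : (a + b) / 2 ≠ b := by intro h; linarith
  fin_cases i <;> fin_cases j <;> simp_all [posIn, h.ne, h.ne']

theorem exists_posIn {a b z : ℝ} (h : a < b) :
    ∃ i, (z = a ↔ posIn a b i = a) ∧ (z = b ↔ posIn a b i = b) := by
  have e1 : (a + b) / 2 ≠ a := by intro h; linarith
  have e2 : (a + b) / 2 ≠ b := by intro h; linarith
  by_cases h1 : z = a
  · exact ⟨0, by simp [posIn, h1]⟩
  · by_cases h2 : z = b
    · exact ⟨2, by simp [posIn, h2, h.ne']⟩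
    · exact ⟨1, by simp [posIn, h1, h2, e1, e2]⟩

theorem rowCode_succ (n : ℕ) (x y : ℕ → ℝ) :
    rowCode (n + 1) x y = (decide (y 0 = x 0), decide (y 0 = x 1)) ::
      rowCode n (fun j => x (j + 1)) fun j => y (j + 1) := by
  simp [rowCode, List.range_succ_eq_map, Function.comp_def]

theorem count_rowCode_const (n : ℕ) (c : ℝ) :
    (rowCode n (fun _ => c) fun _ => c).count (false, false) = 0 := by
  simp [rowCode, List.count_eq_zero]

theorem codePoly_zero (x : ℕ → ℝ) : codePoly 0 x = 1 := by
  have h : gzCodes 0 x = {[]} := by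
    ext c
    constructor
    · rintro ⟨T, -, rfl⟩
      rfl
    · rintro rfl
      exact ⟨fun _ => x, ⟨rfl, fun i j hij => by omega⟩, rfl⟩
  rw [codePoly, h, finsum_mem_singleton]
  simp [freeCount]

theorem codePoly_const (n : ℕ) (c : ℝ) : codePoly n (fun _ => c) = 1 := by
  induction n with
  | zero => exact codePoly_zero _
  | succ n ih =>
    rw [codePoly_succ (fun _ : Unit => fun _ => c) (fun _ j _ => ⟨le_rfl, le_rfl⟩)
      (fun _ _ _ => rfl)]
    · simp [count_rowCode_const, ih]
    · refine fun z hz => ⟨(), rowCode_eq_iff.2 fun j hj => ?_⟩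
      simp [le_antisymm (hz j hj).2 (hz j hj).1]

theorem sameOrder_row3 {n : ℕ} {a b c a' b' c' : ℝ} (h1 : a ≤ b) (h2 : b ≤ c) (h1' : a' ≤ b')
    (h2' : b' ≤ c') (e1 : a = b ↔ a' = b') (e2 : b = c ↔ b' = c') :
    SameOrder n (row3 a b c) (row3 a' b' c') := by
  intro j _
  match j with
  | 0 => exact ⟨h1, h1', e1⟩
  | 1 => exact ⟨h2, h2', e2⟩
  | _ + 2 => simp [row3]

theorem row3_self (c : ℝ) : row3 c c c = fun _ => c := by
  funext j
  match j with
  | 0 | 1 | _ + 2 => rfl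

theorem row3_tail (a c : ℝ) : (fun j => row3 a c c (j + 1)) = fun _ => c := by
  funext j
  match j with
  | 0 | _ + 1 => rfl

theorem rowCode_row3 (n : ℕ) (a b c p q : ℝ) :
    rowCode (n + 2) (row3 a b c) (row3 p q c) =
      (decide (p = a), decide (p = b)) :: (decide (q = b), decide (q = c)) ::
        rowCode n (fun _ => c) fun _ => c := by
  rw [rowCode_succ, rowCode_succ]
  rfl

theorem rowCode_row3' (n : ℕ) (a c p : ℝ) :
    rowCode (n + 1) (row3 a c c) (row3 p c c) =
      (decide (p = a), decide (p = c)) :: rowCode n (fun _ => c) fun _ => c := by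
  rw [rowCode_succ, row3_tail, row3_tail]
  rfl

theorem interlaces_row3 {n : ℕ} {a b c p q : ℝ} (h1 : a ≤ p) (h2 : p ≤ b) (h3 : b ≤ q)
    (h4 : q ≤ c) : Interlaces n (row3 a b c) (row3 p q c) := by
  intro j _
  match j with
  | 0 => exact ⟨h1, h2⟩
  | 1 => exact ⟨h3, h4⟩
  | _ + 2 => simp [row3]

theorem Interlaces.rowCode_eq {n : ℕ} {a b c : ℝ} {z : ℕ → ℝ}
    (hz : Interlaces (n + 2) (row3 a b c) z) :
    rowCode (n + 2) (row3 a b c) z = rowCode (n + 2) (row3 a b c) (row3 (z 0) (z 1) c) := by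
  refine rowCode_eq_iff.2 fun j hj => ?_
  match j with
  | 0 => exact ⟨Iff.rfl, Iff.rfl⟩
  | 1 => exact ⟨Iff.rfl, Iff.rfl⟩
  | j + 2 =>
    have : z (j + 2) = c := le_antisymm (hz _ hj).2 (hz _ hj).1
    simp [row3, this]

theorem Interlaces.rowCode_eq' {n : ℕ} {a c : ℝ} {z : ℕ → ℝ}
    (hz : Interlaces (n + 1) (row3 a c c) z) :
    rowCode (n + 1) (row3 a c c) z = rowCode (n + 1) (row3 a c c) (row3 (z 0) c c) := by
  refine rowCode_eq_iff.2 fun j hj => ?_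
  match j with
  | 0 => exact ⟨Iff.rfl, Iff.rfl⟩
  | 1 =>
    have : z 1 = c := le_antisymm (hz _ hj).2 (hz _ hj).1
    simp [row3, this]
  | j + 2 =>
    have : z (j + 2) = c := le_antisymm (hz _ hj).2 (hz _ hj).1
    simp [row3, this]

/-- The `f`-polynomial of `GZ(2 3^k)`, a simplex. -/
noncomputable def simplexPoly (k : ℕ) : ℤ[X] := codePoly (k + 1) (row3 2 3 3)

/-- The `f`-polynomial of `GZ(1 2 3^k)`. -/
noncomputable def distinctPoly (k : ℕ) : ℤ[X] := codePoly (k + 2) (row3 1 2 3)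

/-- The `f`-polynomial of `GZ(2^2 3^k)`. -/
noncomputable def doublePoly (k : ℕ) : ℤ[X] := codePoly (k + 2) (row3 2 2 3)

theorem codePoly_eq_simplexPoly {k : ℕ} {p : ℝ} (h : p < 3) :
    codePoly (k + 1) (row3 p 3 3) = simplexPoly k :=
  (sameOrder_row3 h.le le_rfl (by norm_num) le_rfl
    (iff_of_false h.ne (by norm_num)) (by norm_num)).codePoly_eq

theorem codePoly_eq_distinctPoly {k : ℕ} {p q : ℝ} (h : p < q) (h' : q < 3) :
    codePoly (k + 2) (row3 p q 3) = distinctPoly k :=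
  (sameOrder_row3 h.le h'.le (by norm_num) (by norm_num)
    (iff_of_false h.ne (by norm_num)) (iff_of_false h'.ne (by norm_num))).codePoly_eq

theorem simplexPoly_zero : simplexPoly 0 = 1 := by
  have h : SameOrder 1 (row3 2 3 3) fun _ => 3 := fun j hj => by omega
  rw [simplexPoly, h.codePoly_eq, codePoly_const]

theorem doublePoly_zero : doublePoly 0 = 1 := by
  have h : SameOrder 2 (row3 2 2 3) fun _ => 2 := fun j hj => by
    obtain rfl : j = 0 := by omega
    simp [row3]
  rw [doublePoly, h.codePoly_eq, codePoly_const]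

theorem simplexPoly_succ (k : ℕ) : simplexPoly (k + 1) = (1 + X) * simplexPoly k + 1 := by
  have h23 : (2 : ℝ) < 3 := by norm_num
  rw [simplexPoly, codePoly_succ (fun i => row3 (posIn 2 3 i) 3 3)]
  · simp only [Fin.sum_univ_three, rowCode_row3', List.count_cons, count_rowCode_const]
    have e : codePoly (k + 1) (row3 (posIn 2 3 2) 3 3) = 1 := by
      simpa [posIn, row3_self] using codePoly_const (k + 1) 3
    rw [e, codePoly_eq_simplexPoly (by norm_num [posIn]), codePoly_eq_simplexPoly
      (by norm_num [posIn])]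
    norm_num [posIn_zero, posIn_one, posIn_two]
    ring
  · intro i
    exact interlaces_row3 (posIn_mem h23 i).1 (posIn_mem h23 i).2 le_rfl le_rfl
  · intro i j h
    simp only [rowCode_row3', List.cons_eq_cons, Prod.mk.injEq, decide_eq_decide] at h
    exact posIn_injective h23 h.1.1 h.1.2
  · intro z hz
    obtain ⟨i, hi⟩ := exists_posIn (z := z 0) h23
    exact ⟨i, by rw [hz.rowCode_eq', rowCode_row3', rowCode_row3', decide_eq_decide.2 hi.1,
      decide_eq_decide.2 hi.2]⟩

/-- The next row is `2, q, 3, …`; the terms correspond to `q = 2`, `2 < q < 3` and `q = 3`. -/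
theorem doublePoly_succ (k : ℕ) :
    doublePoly (k + 1) = doublePoly k + X * distinctPoly k + simplexPoly (k + 1) := by
  have h23 : (2 : ℝ) < 3 := by norm_num
  rw [doublePoly, codePoly_succ (fun i => row3 2 (posIn 2 3 i) 3)]
  · simp only [Fin.sum_univ_three, rowCode_row3, List.count_cons, count_rowCode_const]
    have e0 : codePoly (k + 2) (row3 2 (posIn 2 3 0) 3) = doublePoly k := rfl
    have e2 : codePoly (k + 2) (row3 2 (posIn 2 3 2) 3) = simplexPoly (k + 1) := rfl
    rw [e0, e2, codePoly_eq_distinctPoly (by norm_num [posIn]) (by norm_num [posIn])]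
    norm_num [posIn_zero, posIn_one, posIn_two]
  · intro i
    exact interlaces_row3 le_rfl le_rfl (posIn_mem h23 i).1 (posIn_mem h23 i).2
  · intro i j h
    simp only [rowCode_row3, List.cons_eq_cons, Prod.mk.injEq, decide_eq_decide] at h
    exact posIn_injective h23 h.2.1.1 h.2.1.2
  · intro z hz
    obtain ⟨i, hi⟩ := exists_posIn (z := z 1) h23
    have hz0 : z 0 = 2 := le_antisymm (hz 0 (by omega)).2 (hz 0 (by omega)).1
    exact ⟨i, by rw [hz.rowCode_eq, rowCode_row3, rowCode_row3, decide_eq_decide.2 hi.1,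
      decide_eq_decide.2 hi.2, hz0]⟩

theorem distinctPoly_zero : distinctPoly 0 = X + 2 := by
  have h : SameOrder 2 (row3 1 2 3) (row3 2 3 3) := fun j hj => by
    obtain rfl : j = 0 := by omega
    norm_num [row3]
  have h1 := simplexPoly_succ 0
  rw [simplexPoly_zero, simplexPoly] at h1
  rw [distinctPoly, h.codePoly_eq, h1]
  ring

/-- Nine positions of `(p, q)`: `q = 3` leaves a simplex for each `p`, and `p = q = 2` gives the
double row. The other five keep the pattern `1 2 3^k`, with total weight `X(X + 2) + 1 + X`. -/
theorem distinctPoly_succ (k : ℕ) :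
    distinctPoly (k + 1) = (X + 2) * simplexPoly (k + 1) + (X ^ 2 + 3 * X + 1) * distinctPoly k +
      doublePoly k := by
  have h12 : (1 : ℝ) < 2 := by norm_num
  have h23 : (2 : ℝ) < 3 := by norm_num
  rw [distinctPoly, codePoly_succ
    (fun i : Fin 3 × Fin 3 => row3 (posIn 1 2 i.1) (posIn 2 3 i.2) 3)]
  · simp only [Fintype.sum_prod_type, Fin.sum_univ_three, rowCode_row3, List.count_cons,
      count_rowCode_const]
    have e0 : codePoly (k + 2) (row3 (posIn 1 2 2) (posIn 2 3 0) 3) = doublePoly k := rfl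
    have e2 : ∀ i, codePoly (k + 2) (row3 (posIn 1 2 i) (posIn 2 3 2) 3) = simplexPoly (k + 1) :=
      fun i => codePoly_eq_simplexPoly ((posIn_mem h12 i).2.trans_lt h23)
    have e1 : ∀ i, codePoly (k + 2) (row3 (posIn 1 2 i) (posIn 2 3 1) 3) = distinctPoly k :=
      fun i => codePoly_eq_distinctPoly ((posIn_mem h12 i).2.trans_lt (by norm_num [posIn]))
        (by norm_num [posIn])
    have e00 : codePoly (k + 2) (row3 (posIn 1 2 0) (posIn 2 3 0) 3) = distinctPoly k :=
      codePoly_eq_distinctPoly (by norm_num [posIn]) (by norm_num [posIn])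
    have e10 : codePoly (k + 2) (row3 (posIn 1 2 1) (posIn 2 3 0) 3) = distinctPoly k :=
      codePoly_eq_distinctPoly (by norm_num [posIn]) (by norm_num [posIn])
    rw [e0, e00, e10, e1, e1, e1, e2, e2, e2]
    norm_num [posIn_zero, posIn_one, posIn_two]
    ring
  · intro i
    exact interlaces_row3 (posIn_mem h12 _).1 (posIn_mem h12 _).2 (posIn_mem h23 _).1
      (posIn_mem h23 _).2
  · intro i j h
    simp only [rowCode_row3, List.cons_eq_cons, Prod.mk.injEq, decide_eq_decide] at h
    exact Prod.ext (posIn_injective h12 h.1.1 h.1.2) (posIn_injective h23 h.2.1.1 h.2.1.2)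
  · intro z hz
    obtain ⟨i, hi⟩ := exists_posIn (z := z 0) h12
    obtain ⟨j, hj⟩ := exists_posIn (z := z 1) h23
    exact ⟨(i, j), by rw [hz.rowCode_eq, rowCode_row3, rowCode_row3, decide_eq_decide.2 hi.1,
      decide_eq_decide.2 hi.2, decide_eq_decide.2 hj.1, decide_eq_decide.2 hj.2]⟩

theorem fPolynomial_gz_append_replicate (k : ℕ) {a b : ℝ} (h1 : a ≤ b) (h2 : b ≤ 3) :
    fPolynomial (gzPolytope ([a, b] ++ List.replicate k 3)) = codePoly (k + 2) (row3 a b 3) := by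
  have key : ∀ j < k + 2, ([a, b] ++ List.replicate k 3).getD j 0 = row3 a b 3 j := by
    intro j hj
    match j with
    | 0 => rfl
    | 1 => rfl
    | j + 2 =>
      have : j < k := by omega
      simp [row3, this]
  have hlen : ([a, b] ++ List.replicate k 3).length = k + 2 := by simp
  rw [fPolynomial_gzPolytope, hlen]
  -- Beyond the list one row continues with the default `0` and the other with `3`; only the first
  -- `k + 2` entries matter.
  refine SameOrder.codePoly_eq fun j hj => ?_
  rw [key j (by omega), key (j + 1) hj]
  have h := sameOrder_row3 (n := k + 2) h1 h2 h1 h2 Iff.rfl Iff.rfl j hj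
  exact ⟨h.1, h.1, Iff.rfl⟩

theorem hPolynomial_gz_distinct (k : ℕ) :
    hPolynomial (gzPolytope ([1, 2] ++ List.replicate k 3)) = (distinctPoly k).comp (X - 1) := by
  rw [hPolynomial, fPolynomial_gz_append_replicate k (by norm_num) (by norm_num), distinctPoly]

theorem hPolynomial_gz_double (k : ℕ) :
    hPolynomial (gzPolytope ([2, 2] ++ List.replicate k 3)) = (doublePoly k).comp (X - 1) := by
  rw [hPolynomial, fPolynomial_gz_append_replicate k le_rfl (by norm_num), doublePoly]

end Recurrences

/-! ### Solving the recurrences by convolution with `Φ` -/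

section ClosedForms

theorem gzPhi_add_two (k : ℕ) :
    gzPhi (k + 2) = (X ^ 2 + X) * gzPhi (k + 1) - X ^ 2 * gzPhi k := rfl

/-- The geometric sum `1 + s + ⋯ + s^k`, the `h`-polynomial of a simplex. -/
theorem simplexPoly_comp (k : ℕ) :
    (simplexPoly k).comp (X - 1) = ∑ j ∈ Finset.range (k + 1), X ^ j := by
  induction k with
  | zero => simp [simplexPoly_zero]
  | succ k ih =>
    rw [simplexPoly_succ, geom_sum_succ, ← ih]
    simp

theorem simplexPoly_comp_succ (k : ℕ) :
    (simplexPoly (k + 1)).comp (X - 1) = (simplexPoly k).comp (X - 1) + X ^ (k + 1) := by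
  rw [simplexPoly_comp, simplexPoly_comp, Finset.sum_range_succ _ (k + 1)]

/-- Convolution with `Φ` solves the inhomogeneous recurrence with source `g`: the term `j = k + 2`
contributes `g (k + 2)` as `Φ 1 = 1`, and `j = k + 1` fits the recurrence because `Φ 0 = 0`. -/
theorem sum_mul_gzPhi_add_two (g : ℕ → ℤ[X]) (k : ℕ) :
    ∑ j ∈ Finset.range (k + 3), g j * gzPhi (k + 2 - j + 1) =
      (X ^ 2 + X) * ∑ j ∈ Finset.range (k + 2), g j * gzPhi (k + 1 - j + 1) -
        X ^ 2 * ∑ j ∈ Finset.range (k + 1), g j * gzPhi (k - j + 1) + g (k + 2) := by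
  have e : ∀ j ∈ Finset.range (k + 1), g j * gzPhi (k + 2 - j + 1) =
      (X ^ 2 + X) * (g j * gzPhi (k + 1 - j + 1)) - X ^ 2 * (g j * gzPhi (k - j + 1)) := by
    intro j hj
    obtain ⟨m, rfl⟩ := Nat.exists_eq_add_of_le (Nat.lt_succ_iff.1 (Finset.mem_range.1 hj))
    rw [show j + m + 2 - j + 1 = m + 1 + 2 by omega, show j + m + 1 - j + 1 = m + 1 + 1 by omega,
      show j + m - j + 1 = m + 1 by omega, gzPhi_add_two]
    ring
  rw [Finset.sum_range_succ, Finset.sum_range_succ _ (k + 1), Finset.sum_congr rfl e,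
    Finset.sum_sub_distrib, ← Finset.mul_sum, ← Finset.mul_sum,
    Finset.sum_range_succ _ (k + 1)]
  simp [gzPhi]
  ring

theorem distinctPoly_comp (k : ℕ) :
    (distinctPoly k).comp (X - 1) =
      ∑ j ∈ Finset.range (k + 1), (∑ i ∈ Finset.range (j + 2), X ^ i) * gzPhi (k - j + 1) := by
  induction k using Nat.twoStepInduction with
  | zero =>
    rw [distinctPoly_zero]
    simp [gzPhi, Finset.sum_range_succ]
    ring
  | one =>
    rw [distinctPoly_succ, distinctPoly_zero, doublePoly_zero, simplexPoly_succ, simplexPoly_zero]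
    simp [gzPhi, Finset.sum_range_succ]
    ring
  | more k ih ih1 =>
    rw [sum_mul_gzPhi_add_two fun j => ∑ i ∈ Finset.range (j + 2), X ^ i, ← ih, ← ih1,
      ← simplexPoly_comp]
    have h1 := congrArg (fun p : ℤ[X] => p.comp (X - 1)) (distinctPoly_succ k)
    have h2 := congrArg (fun p : ℤ[X] => p.comp (X - 1)) (distinctPoly_succ (k + 1))
    have h3 := congrArg (fun p : ℤ[X] => p.comp (X - 1)) (doublePoly_succ k)
    have h4 := simplexPoly_comp_succ (k + 1)
    have h5 := simplexPoly_comp_succ (k + 2)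
    simp only [add_comp, mul_comp, pow_comp, X_comp, one_comp, ofNat_comp, Nat.cast_ofNat]
      at h1 h2 h3
    -- The difference `h2 - h1` contains `B` only as `B (k+1) - B k`, which `h3` expresses through
    -- `D` and `S`. The source becomes `S (k+1) + s^(k+2) + s^(k+3) = S (k+3)`.
    linear_combination h2 - h1 + h3 + X * h4 - h5

theorem doublePoly_comp_succ (k : ℕ) :
    (doublePoly (k + 1)).comp (X - 1) =
      ∑ j ∈ Finset.range (k + 1), X ^ (j + 2) * gzPhi (k - j + 1) +
        (simplexPoly (k + 1)).comp (X - 1) := by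
  induction k using Nat.twoStepInduction with
  | zero =>
    rw [doublePoly_succ, distinctPoly_zero, doublePoly_zero]
    simp [gzPhi]
    ring
  | one =>
    rw [doublePoly_succ, doublePoly_succ, distinctPoly_succ, distinctPoly_zero, doublePoly_zero,
      simplexPoly_succ, simplexPoly_succ, simplexPoly_zero]
    simp [gzPhi, Finset.sum_range_succ]
    ring
  | more k ih ih1 =>
    rw [sum_mul_gzPhi_add_two fun j => X ^ (j + 2), ← sub_eq_iff_eq_add.2 ih,
      ← sub_eq_iff_eq_add.2 ih1]
    have h1 := congrArg (fun p : ℤ[X] => p.comp (X - 1)) (distinctPoly_succ (k + 1))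
    have h2 := congrArg (fun p : ℤ[X] => p.comp (X - 1)) (doublePoly_succ (k + 1))
    have h3 := congrArg (fun p : ℤ[X] => p.comp (X - 1)) (doublePoly_succ (k + 2))
    have h4 := simplexPoly_comp_succ (k + 1)
    simp only [add_comp, mul_comp, pow_comp, X_comp, one_comp, ofNat_comp, Nat.cast_ofNat]
      at h1 h2 h3
    linear_combination h3 + (X - 1) * h1 - (X ^ 2 + X - 1) * h2 + X ^ 2 * h4

theorem doublePoly_comp (k : ℕ) :
    (doublePoly k).comp (X - 1) =
      ∑ j ∈ Finset.range (k + 1), X ^ (j + 2) * gzPhi (k - j) +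
        ∑ i ∈ Finset.range (k + 1), X ^ i := by
  cases k with
  | zero => simp [doublePoly_zero, gzPhi]
  | succ k =>
    rw [doublePoly_comp_succ, simplexPoly_comp,
      -- The split-off term `j = k + 1` vanishes because `Φ 0 = 0`.
      Finset.sum_range_succ (fun j => X ^ (j + 2) * gzPhi (k + 1 - j)) (k + 1)]
    have e : ∀ j ∈ Finset.range (k + 1), X ^ (j + 2) * gzPhi (k - j + 1) =
        X ^ (j + 2) * gzPhi (k + 1 - j) := by
      intro j hj
      rw [Nat.sub_add_comm (Nat.lt_succ_iff.1 (Finset.mem_range.1 hj))]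
    rw [Finset.sum_congr rfl e]
    simp [gzPhi]

end ClosedForms

theorem mainTheorem3 (k : ℕ) :
    algebraMap ℤ[X] (RatFunc ℤ)
        (hPolynomial (gzPolytope ([1, 2] ++ List.replicate k 3))) =
      ∑ j ∈ Finset.range (k + 1),
        (RatFunc.X ^ (j + 2) - 1) / (RatFunc.X - 1) *
          algebraMap ℤ[X] (RatFunc ℤ) (gzPhi (k - j + 1)) ∧
    algebraMap ℤ[X] (RatFunc ℤ)
        (hPolynomial (gzPolytope ([2, 2] ++ List.replicate k 3))) =
      (∑ j ∈ Finset.range (k + 1),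
        RatFunc.X ^ (j + 2) * algebraMap ℤ[X] (RatFunc ℤ) (gzPhi (k - j))) +
      (RatFunc.X ^ (k + 1) - 1) / (RatFunc.X - 1) := by
  have hX : (RatFunc.X : RatFunc ℤ) ≠ 1 := by
    rw [← RatFunc.algebraMap_X, ← map_one (algebraMap ℤ[X] (RatFunc ℤ))]
    exact fun h => X_ne_C (1 : ℤ) (by simpa using RatFunc.algebraMap_injective ℤ h)
  constructor
  · rw [hPolynomial_gz_distinct, distinctPoly_comp]
    simp only [map_sum, map_mul, map_pow, RatFunc.algebraMap_X, geom_sum_eq hX]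
  · rw [hPolynomial_gz_double, doublePoly_comp]
    simp only [map_add, map_sum, map_mul, map_pow, RatFunc.algebraMap_X, geom_sum_eq hX]
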